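/- Let $\Bbbk$ be a field of characteristic $0$, let $n_1,\dots,n_d$ and $r_1,\dots,r_m$ be positive integers, and put $R=r_1\cdots r_m$. A tensor $\mathcal A\in\Bbbk^{n_1\times\cdots\times n_d}$ has rank $1$ if it is nonzero and of the form $\mathbf a_1\otimes\cdots\otimes\mathbf a_d$ with $\mathbf a_i\in\Bbbk^{n_i}$; the rank of $\mathcal T$ is the least number of rank-$1$ tensors with sum $\mathcal T$. A tensor $\mathcal T$ is called $R$-identifiable if it has rank $R$ and there is, up to order, exactly one $R$-tuple of rank-$1$ tensors with sum $\mathcal T$. Let $\sigma^\circ_{\mathbf r}$ be the set of all Hadamard (entrywise) products $\mathcal T_1\odot\cdots\odot\mathcal T_m$ of tensors $\mathcal T_k\in\Bbbk^{n_1\times\cdots\times n_d}$ with $\operatorname{rank}\mathcal T_k\le r_k$, and let $\sigma_{\mathbf r}$ be its Zariski closure in $\Bbbk^{n_1\times\cdots\times n_d}$. Suppose that there is a partition $I\sqcup J\sqcup K=\{1,\dots,d\}$ such that, with $\Pi_X:=\prod_{x\in X}n_x$, $$\Pi_I\ge\Pi_J\ge\Pi_K\ge 2\quad\text{and}\quad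 R\le \Pi_I+\min\{\tfrac12\delta,\delta\},\qquad \delta:=\Pi_J+\Pi_K-\Pi_I-2 .$$ Then a generic tensor admitting such a decomposition is $R$-identifiable: there is a Zariski-closed set $Z\subsetneq\sigma_{\mathbf r}$ such that every $\mathcal T\in\sigma^\circ_{\mathbf r}\setminus Z$ is $R$-identifiable over $\Bbbk$. If moreover $\Bbbk$ is algebraically closed, then a generic tensor of $\sigma_{\mathbf r}$ is $R$-identifiable: there is a Zariski-closed set $Z\subsetneq\sigma_{\mathbf r}$ such that every $\mathcal T\in\sigma_{\mathbf r}\setminus Z$ is $R$-identifiable. -/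

import Mathlib

namespace HHD

/-- Tensors of shape `n₁ × ⋯ × n_d` with coefficients in `𝕜`, in coordinates.
The Hadamard product is the pointwise product of the function space. -/
abbrev Tensor (𝕜 : Type*) {d : ℕ} (n : Fin d → ℕ) : Type _ :=
  (∀ i : Fin d, Fin (n i)) → 𝕜

/-- The tensor product `a₁ ⊗ ⋯ ⊗ a_d` of vectors `aᵢ ∈ 𝕜^{nᵢ}`. -/
def outer {𝕜 : Type*} [Field 𝕜] {d : ℕ} {n : Fin d → ℕ}
    (a : ∀ i : Fin d, Fin (n i) → 𝕜) : Tensor 𝕜 n :=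
  fun j => ∏ i, a i (j i)

/-- Rank-1 tensors: nonzero tensor products of vectors. -/
def IsRankOne {𝕜 : Type*} [Field 𝕜] {d : ℕ} {n : Fin d → ℕ} (A : Tensor 𝕜 n) : Prop :=
  A ≠ 0 ∧ ∃ a : ∀ i : Fin d, Fin (n i) → 𝕜, A = outer a

/-- The decompositions of `T` as a sum of `r` rank-1 tensors, up to the order of the summands:
unordered `r`-tuples (with multiplicities) of rank-1 tensors with sum `T`. -/
def decompositions {𝕜 : Type*} [Field 𝕜] {d : ℕ} {n : Fin d → ℕ} (r : ℕ) (T : Tensor 𝕜 n) :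
    Set (Sym (Tensor 𝕜 n) r) :=
  {A | (∀ B ∈ A, IsRankOne B) ∧ (A : Multiset (Tensor 𝕜 n)).sum = T}

/-- The tensor rank: the least length of a decomposition into rank-1 tensors. -/
noncomputable def tensorRank {𝕜 : Type*} [Field 𝕜] {d : ℕ} {n : Fin d → ℕ}
    (T : Tensor 𝕜 n) : ℕ :=
  sInf {r : ℕ | (decompositions r T).Nonempty}

/-- The infimum defining `tensorRank` is over a nonempty set for tensors of positive order. -/
theorem exists_decomposition {𝕜 : Type*} [Field 𝕜] {d : ℕ} {n : Fin d → ℕ} (hd : 0 < d)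
    (T : Tensor 𝕜 n) : ∃ r, (decompositions r T).Nonempty := by
  classical
  let s : Finset (∀ i : Fin d, Fin (n i)) := Finset.univ.filter fun j => T j ≠ 0
  let M : Multiset (Tensor 𝕜 n) := s.val.map fun j => Pi.single j (T j)
  refine ⟨M.card, ⟨M, rfl⟩, ?_, ?_⟩
  · intro B hB
    have hB' : B ∈ M := hB
    obtain ⟨j, hj, rfl⟩ := Multiset.mem_map.1 hB'
    have hj' : T j ≠ 0 := (Finset.mem_filter.1 hj).2
    refine ⟨fun h => hj' (by simpa using congrFun h j), ?_⟩
    refine ⟨fun i => Pi.single (j i) (if i = ⟨0, hd⟩ then T j else 1), ?_⟩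
    funext l
    by_cases hl : l = j
    · subst hl
      simp [outer]
    · obtain ⟨i, hi⟩ := Function.ne_iff.1 hl
      rw [Pi.single_eq_of_ne hl]
      exact (Finset.prod_eq_zero (Finset.mem_univ i) (Pi.single_eq_of_ne hi _)).symm
  · change (∑ j ∈ s, Pi.single j (T j) : Tensor 𝕜 n) = T
    rw [Finset.sum_filter_of_ne (fun j _ h => by
      intro h0
      exact h (by rw [h0, Pi.single_zero]))]
    exact Finset.univ_sum_single T

/-- A tensor is `r`-identifiable if it has rank `r` and exactly one decomposition of length `r`,
up to the order of the summands. -/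
def IsIdentifiable {𝕜 : Type*} [Field 𝕜] {d : ℕ} {n : Fin d → ℕ} (r : ℕ)
    (T : Tensor 𝕜 n) : Prop :=
  tensorRank T = r ∧ ∃ A, decompositions r T = {A}

/-- The tensors that are Hadamard products `T₁ ⊙ ⋯ ⊙ T_m` with `rank T_k ≤ r_k`. -/
def hhdSet (𝕜 : Type*) [Field 𝕜] {d : ℕ} (n : Fin d → ℕ) {m : ℕ} (r : Fin m → ℕ) :
    Set (Tensor 𝕜 n) :=
  {T | ∃ F : Fin m → Tensor 𝕜 n, (∀ k, tensorRank (F k) ≤ r k) ∧ T = ∏ k, F k}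

/-- Zariski-closed subsets of the affine space `𝕜^ι`. -/
def IsZariskiClosed {𝕜 : Type*} [Field 𝕜] {ι : Type*} (Z : Set (ι → 𝕜)) : Prop :=
  ∃ I : Ideal (MvPolynomial ι 𝕜), Z = MvPolynomial.zeroLocus 𝕜 I

/-- The Zariski closure of a subset of the affine space `𝕜^ι`. -/
def zariskiClosure {𝕜 : Type*} [Field 𝕜] {ι : Type*} (S : Set (ι → 𝕜)) : Set (ι → 𝕜) :=
  MvPolynomial.zeroLocus 𝕜 (MvPolynomial.vanishingIdeal 𝕜 S)

/-- The variety `σ_r(S)`: the Zariski closure of the set of Hadamard products of tensors of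
rank at most `r₁, …, r_m`. -/
def hhdVariety (𝕜 : Type*) [Field 𝕜] {d : ℕ} (n : Fin d → ℕ) {m : ℕ} (r : Fin m → ℕ) :
    Set (Tensor 𝕜 n) :=
  zariskiClosure (hhdSet 𝕜 n r)

/-- `P` holds generically on `V`: it holds at all points of `V` outside a Zariski-closed
subset `Z ⊊ V`. -/
def Generically {𝕜 : Type*} [Field 𝕜] {ι : Type*} (V : Set (ι → 𝕜))
    (P : (ι → 𝕜) → Prop) : Prop :=
  ∃ Z : Set (ι → 𝕜), IsZariskiClosed Z ∧ Z ⊂ V ∧ ∀ x ∈ V, x ∉ Z → P x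

/-- `R` lies in the range of the reshaped Kruskal criterion for the blocks `I`, `J`, `K`:
with `Π_X = ∏_{x ∈ X} n_x` and `δ = Π_J + Π_K - Π_I - 2`, one has `Π_I ≥ Π_J ≥ Π_K ≥ 2` and
`R ≤ Π_I + min (δ / 2) δ`. -/
def InKruskalRange {d : ℕ} (n : Fin d → ℕ) (I J K : Finset (Fin d)) (R : ℕ) : Prop :=
  (∏ x ∈ J, n x) ≤ ∏ x ∈ I, n x ∧ (∏ x ∈ K, n x) ≤ ∏ x ∈ J, n x ∧ 2 ≤ ∏ x ∈ K, n x ∧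
    let δ : ℚ := (∏ x ∈ J, (n x : ℚ)) + (∏ x ∈ K, (n x : ℚ)) - (∏ x ∈ I, (n x : ℚ)) - 2
    (R : ℚ) ≤ (∏ x ∈ I, (n x : ℚ)) + min (1 / 2 * δ) δ

end HHD

namespace HHD

-- An entrywise product of tensor products is again a tensor product, so multiplying out `T₁ ⊙ ⋯ ⊙
-- T_m` gives a sum of `R` tensor products indexed by `∀ k, Fin (r k)`. This is the polynomial map
-- `hadamardMap` in the entries of the factors. Grouping the modes into the blocks `I`, `J`, `K`
-- turns the sum into an order-three decomposition, to which `kruskal` applies once the Kruskal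
-- ranks of the three families of block vectors, capped at `R`, add up to at least `2R + 2`. The
-- numerical hypothesis gives this bound when each capped rank is `min R Π_X` and `R ≠ 1`; for `R =
-- 1` uniqueness is trivial.
--
-- These ranks are attained off the zero set of one polynomial `b` in the parameters, namely a
-- product of minors. It is nonzero because at a parameter made of powers of `2` the minors are
-- Vandermonde determinants with distinct nodes (`exists_polynomial_hasKRank`).
--
-- The open condition `b ≠ 0` has to be moved from parameters to tensors. By Chevalley's theorem and
-- the Nullstellensatz (`exists_dominant_lift`), every tensor of the variety off a proper closed
-- subset has a parameter with `b ≠ 0`, though only over an algebraically closed `Ω`. This suffices: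
-- a decomposition over the base field stays one over `Ω`, where Kruskal's theorem determines it,
-- and extending scalars is injective on tensors (`isIdentifiable_of_hasKRank`). Membership in
-- `hhdSet` is used only to have a decomposition over the base field; if `𝕜` is algebraically
-- closed, `Ω = 𝕜` supplies it.

-- Lifting points along a polynomial map

universe u v w in
open TensorProduct in
/-- A prime `q` of `B` and a field-valued point `g` of `A` lying under it have a common
field-valued point. -/
theorem exists_common_field_point {A : Type u} {B : Type v} {Ω : Type w}
    [CommRing A] [CommRing B] [Field Ω]
    (f : A →+* B) (g : A →+* Ω) (q : Ideal B) [q.IsPrime] (h : RingHom.ker g = q.comap f) :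
    ∃ (M : Type (max v w)) (_ : Field M) (u : B →+* M) (v : Ω →+* M),
      u.comp f = v.comp g ∧ ∀ b, b ∉ q → u b ≠ 0 := by
  let p := RingHom.ker g
  have hp : p.IsPrime := RingHom.ker_isPrime g
  let κL : p.ResidueField →+* q.ResidueField := Ideal.ResidueField.map p q f h
  let κΩ : p.ResidueField →+* Ω := Ideal.ResidueField.lift p g le_rfl (by
    intro x hx
    exact IsUnit.mk0 _ (fun h0 => hx h0))
  let := κL.toAlgebra
  let := κΩ.toAlgebra
  -- A tensor product of two nonzero algebras over a field is nonzero, so it has a residue field,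
  -- into which both factors embed.
  obtain ⟨m, hm⟩ := Ideal.exists_maximal (Ω ⊗[p.ResidueField] q.ResidueField)
  let : Field ((Ω ⊗[p.ResidueField] q.ResidueField) ⧸ m) := Ideal.Quotient.field m
  let v : Ω →+* (Ω ⊗[p.ResidueField] q.ResidueField) ⧸ m :=
    (Ideal.Quotient.mk m).comp Algebra.TensorProduct.includeLeftRingHom
  let w : q.ResidueField →+* (Ω ⊗[p.ResidueField] q.ResidueField) ⧸ m :=
    (Ideal.Quotient.mk m).comp
      (Algebra.TensorProduct.includeRight :
        q.ResidueField →ₐ[p.ResidueField] Ω ⊗[p.ResidueField] q.ResidueField).toRingHom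
  refine ⟨_, inferInstance, w.comp (algebraMap B q.ResidueField), v, ?_, ?_⟩
  · ext x
    have h1 : algebraMap B q.ResidueField (f x) =
        algebraMap p.ResidueField q.ResidueField (algebraMap A _ x) :=
      (Ideal.ResidueField.map_algebraMap p q f h x).symm
    have h2 : g x = algebraMap p.ResidueField Ω (algebraMap A _ x) :=
      (Ideal.ResidueField.lift_algebraMap (I := p) g _ _ x).symm
    simp only [RingHom.comp_apply]
    rw [h1, h2]
    change Ideal.Quotient.mk m (Algebra.TensorProduct.includeRight _) =
      Ideal.Quotient.mk m (Algebra.TensorProduct.includeLeft (S := p.ResidueField) _)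
    rw [AlgHom.commutes, AlgHom.commutes]
  · intro b hb h0
    have h1 := (map_eq_zero w).1 h0
    exact hb (by simpa using h1)

/-- A point of a constructible set has a neighbourhood in its closure inside the set. -/
theorem exists_mem_of_isConstructible {A : Type*} [CommRing A] {S : Set (PrimeSpectrum A)}
    (hS : Topology.IsConstructible S) {x : PrimeSpectrum A} (hx : x ∈ S) :
    ∃ a, a ∉ x.asIdeal ∧ ∀ y : PrimeSpectrum A, x.asIdeal ≤ y.asIdeal → a ∉ y.asIdeal → y ∈ S := by
  obtain ⟨C, rfl⟩ := PrimeSpectrum.exists_constructibleSetData_iff.mpr hS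
  simp only [PrimeSpectrum.ConstructibleSetData.toSet, Set.mem_iUnion] at hx ⊢
  -- The piece `D` containing `x` is a closed set cut by a basic open set `D.f ≠ 0`; the closed
  -- condition passes to all specializations of `x`.
  obtain ⟨D, hD, hx1, hx2⟩ := hx
  refine ⟨D.f, by simpa using hx2, fun y hxy hy => ⟨D, hD, ?_, by simpa using hy⟩⟩
  exact fun z hz => hxy (hx1 hz)

open MvPolynomial in
/-- The image of a nonempty basic open set under a polynomial map contains, over every
algebraically closed extension, a nonempty basic open subset of the closure of the image. -/
theorem exists_dominant_lift {𝕜 Ω : Type*} [Field 𝕜] [Field Ω] [IsAlgClosed Ω] [Algebra 𝕜 Ω]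
    {ι P : Type*} [Finite ι] [Finite P] (φ : MvPolynomial ι 𝕜 →ₐ[𝕜] MvPolynomial P 𝕜)
    {b : MvPolynomial P 𝕜} (hb : b ≠ 0) :
    ∃ a, φ a ≠ 0 ∧ ∀ t : ι → Ω, (∀ f, φ f = 0 → aeval t f = 0) → aeval t a ≠ 0 →
      ∃ p : P → Ω, aeval p b ≠ 0 ∧ ∀ i, aeval p (φ (X i)) = t i := by
  have hfp : φ.toRingHom.FinitePresentation := by
    have : φ.toRingHom.FiniteType := by
      have h2 : (algebraMap 𝕜 (MvPolynomial P 𝕜)).FiniteType :=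
        RingHom.finiteType_algebraMap.2 inferInstance
      rw [← φ.comp_algebraMap] at h2
      exact RingHom.FiniteType.of_comp_finiteType h2
    exact RingHom.FinitePresentation.of_finiteType.1 this
  have hc := PrimeSpectrum.isConstructible_comap_image hfp
    (PrimeSpectrum.isConstructible_basicOpen (f := b))
  -- The generic point of parameter space maps to `ker φ`, the generic point of the closure of the
  -- image.
  have hbot : (⟨⊥, Ideal.isPrime_bot⟩ : PrimeSpectrum (MvPolynomial P 𝕜)) ∈
      (PrimeSpectrum.basicOpen b : Set (PrimeSpectrum (MvPolynomial P 𝕜))) := by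
    simpa using hb
  obtain ⟨a, ha, H⟩ := exists_mem_of_isConstructible hc (Set.mem_image_of_mem _ hbot)
  refine ⟨a, fun h0 => ha (by simpa using h0), fun t ht hta => ?_⟩
  let g : MvPolynomial ι 𝕜 →+* Ω := (aeval t : MvPolynomial ι 𝕜 →ₐ[𝕜] Ω).toRingHom
  obtain ⟨q, hq, hqp⟩ := H ⟨RingHom.ker g, RingHom.ker_isPrime g⟩
    (fun f hf => ht f (by simpa using hf)) (fun h0 => hta h0)
  have hbq : b ∉ q.asIdeal := by simpa using hq
  have hker : RingHom.ker g = q.asIdeal.comap φ.toRingHom :=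
    (congrArg PrimeSpectrum.asIdeal hqp).symm
  obtain ⟨M, _, u, v, huv, hu⟩ := exists_common_field_point φ.toRingHom g q.asIdeal hker
  let J : Ideal (MvPolynomial P Ω) :=
    Ideal.span (Set.range fun i => map (algebraMap 𝕜 Ω) (φ (X i)) - C (t i))
  let e : MvPolynomial P Ω →+* M := eval₂Hom v (fun j => u (X j))
  have he : ∀ f : MvPolynomial P 𝕜, e (map (algebraMap 𝕜 Ω) f) = u f := by
    intro f
    have : e.comp (map (algebraMap 𝕜 Ω)) = u := by
      apply MvPolynomial.ringHom_ext
      · intro r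
        have := RingHom.congr_fun huv (C r)
        have hφ : φ (C r) = C r := φ.commutes r
        simp [e, g, hφ] at this ⊢
        exact this.symm
      · intro i; simp [e]
    exact RingHom.congr_fun this f
  have heJ : J ≤ RingHom.ker e := by
    rw [Ideal.span_le]
    rintro _ ⟨i, rfl⟩
    have := RingHom.congr_fun huv (X i)
    simp only [SetLike.mem_coe, RingHom.mem_ker, map_sub, he]
    simp [g, e] at this ⊢
    rw [this, sub_self]
  -- `J` cuts out the fibre over `t`. The `M`-valued point `e` kills `J` but not `b`, so no power of
  -- `b` lies in `J`, and the Nullstellensatz yields an `Ω`-point of the fibre with `b ≠ 0`.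
  have hbJ : map (algebraMap 𝕜 Ω) b ∉ vanishingIdeal Ω (zeroLocus Ω J) := by
    rw [vanishingIdeal_zeroLocus_eq_radical]
    rintro ⟨N, hN⟩
    have := heJ hN
    rw [RingHom.mem_ker, map_pow, he] at this
    exact hu b hbq (eq_zero_of_pow_eq_zero this)
  rw [mem_vanishingIdeal_iff] at hbJ
  push Not at hbJ
  obtain ⟨p, hp, hpb⟩ := hbJ
  refine ⟨p, by simpa [aeval_map_algebraMap] using hpb, fun i => ?_⟩
  have := hp _ (Ideal.subset_span ⟨i, rfl⟩)
  rw [map_sub, aeval_map_algebraMap, sub_eq_zero] at this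
  simpa using this

open Finset Module

/-! ### Kruskal's theorem for third-order tensors -/

section Kruskal

variable {F : Type*} [Field F] {ι : Type*} [Fintype ι] {V : Type*} [AddCommGroup V] [Module F V]

/-- Any `k` members of the family `v` are linearly independent (the Kruskal rank is at least
`k`). -/
def HasKRank (F : Type*) [Field F] {ι V : Type*} [AddCommGroup V] [Module F V] (k : ℕ)
    (v : ι → V) : Prop :=
  ∀ s : Finset ι, #s ≤ k → LinearIndepOn F v (s : Set ι)

theorem span_singleton_sup_eq_of_mem {W : Submodule F V} {u v : V}
    (hv : v ∈ Submodule.span F {u} ⊔ W) (hvW : v ∉ W) :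
    Submodule.span F {v} ⊔ W = Submodule.span F {u} ⊔ W := by
  refine ((Submodule.wcovBy_span_singleton_sup u W).eq_or_eq le_sup_right
    (sup_le ?_ le_sup_right)).resolve_left ?_
  · rwa [Submodule.span_singleton_le_iff_mem]
  · intro h
    exact hvW (h ▸ Submodule.mem_sup_left (Submodule.mem_span_singleton_self v))

-- The flats generated over `W` by one more vector meet only in `W`, so vectors outside `W` are
-- sorted by the flat they generate. This is the count behind the induction in `card_mem_span_le`.
open Classical in
theorem card_mem_span_singleton_sup (c : ι → V) (W : Submodule F V) (u : V) :
    #{i | c i ∈ Submodule.span F {u} ⊔ W} = #{i | c i ∈ W} +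
      #{i ∈ ({i | c i ∉ W} : Finset ι) |
        Submodule.span F {c i} ⊔ W = Submodule.span F {u} ⊔ W} := by
  rw [← card_union_of_disjoint]
  · congr 1
    ext i
    simp only [mem_filter, mem_univ, true_and, mem_union]
    constructor
    · intro h
      by_cases hW : c i ∈ W
      · exact Or.inl hW
      · exact Or.inr ⟨hW, span_singleton_sup_eq_of_mem h hW⟩
    · rintro (h | ⟨_, h⟩)
      · exact Submodule.mem_sup_right h
      · exact h ▸ Submodule.mem_sup_left (Submodule.mem_span_singleton_self _)
  · rw [disjoint_left]
    intro i hi hi'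
    simp only [mem_filter, mem_univ, true_and] at hi hi'
    exact hi'.1 hi

theorem HasKRank.le_finrank_span {ι : Type*} [FiniteDimensional F V] {k : ℕ} {c : ι → V}
    (hc : HasKRank F k c) (s : Finset ι) :
    min #s k ≤ finrank F (Submodule.span F (c '' (s : Set ι))) := by
  obtain ⟨t, hts, ht⟩ := exists_subset_card_eq (s := s) (n := min #s k) (min_le_left _ _)
  have hli := hc t (ht ▸ min_le_right _ _)
  have h1 := finrank_span_eq_card hli
  have h2 : Fintype.card (t : Set ι) = min #s k := by simp [ht]
  rw [← h2, ← h1]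
  refine Submodule.finrank_mono (Submodule.span_mono ?_)
  rintro _ ⟨i, rfl⟩
  exact ⟨i, hts i.2, rfl⟩

open Classical in
/-- Flats spanned by members of `c'` contain at least as many members of `c` as of `c'`. -/
theorem card_mem_span_le [FiniteDimensional F V] {c c' : ι → V} {k : ℕ}
    (hk : k ≤ Fintype.card ι) (hc : HasKRank F k c)
    (hw : ∀ x : Dual F V, #{i | x (c' i) ≠ 0} + k ≤ Fintype.card ι + 1 →
      #{i | x (c i) ≠ 0} ≤ #{i | x (c' i) ≠ 0}) (W : Submodule F V) :
    ∀ Q : Finset ι, W = Submodule.span F (c' '' (Q : Set ι)) →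
      #{i | c' i ∈ W} ≤ #{i | c i ∈ W} := by
  have hspan : ∀ j, c j ∈ Submodule.span F (Set.range c') := by
    intro j
    by_contra hj
    obtain ⟨x, hx, hle⟩ := Submodule.exists_le_ker_of_notMem hj
    have h0 : #{i | x (c' i) ≠ 0} = 0 := by
      rw [card_eq_zero, filter_eq_empty_iff]
      intro i _ h
      exact h (hle (Submodule.subset_span ⟨i, rfl⟩))
    have := hw x (by omega)
    rw [h0, Nat.le_zero, card_eq_zero, filter_eq_empty_iff] at this
    exact this (mem_univ j) hx
  -- Induction from large flats to small ones; the step depends on whether the codimension of `W` in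
  -- the span of `c'` is zero, one or larger.
  induction W using WellFoundedGT.induction with
  | ind W ih =>
  intro Q hQ
  by_cases h0 : ∀ i, c' i ∈ W
  · refine card_le_card fun i _ => ?_
    simp only [mem_filter, mem_univ, true_and]
    exact Submodule.span_le.2 (Set.range_subset_iff.2 h0) (hspan i)
  push Not at h0
  obtain ⟨j₀, hj₀⟩ := h0
  by_cases h1 : ∀ i, c' i ∈ Submodule.span F {c' j₀} ⊔ W
  · obtain ⟨x, hx, hle⟩ := Submodule.exists_le_ker_of_notMem hj₀
    have key : ∀ v ∈ Submodule.span F {c' j₀} ⊔ W, x v = 0 → v ∈ W := by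
      intro v hv hxv
      obtain ⟨y, hy, w, hwW, rfl⟩ := Submodule.mem_sup.1 hv
      obtain ⟨r, rfl⟩ := Submodule.mem_span_singleton.1 hy
      have hxw : x w = 0 := hle hwW
      rw [map_add, hxw, add_zero, map_smul, smul_eq_mul, mul_eq_zero] at hxv
      rw [hxv.resolve_right hx, zero_smul, zero_add]
      exact hwW
    have hall : Submodule.span F (Set.range c') ≤ Submodule.span F {c' j₀} ⊔ W :=
      Submodule.span_le.2 (Set.range_subset_iff.2 h1)
    have e1 : ∀ u : ι → V, (∀ i, u i ∈ Submodule.span F {c' j₀} ⊔ W) →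
        #{i | u i ∈ W} + #{i | x (u i) ≠ 0} = Fintype.card ι := by
      intro u hu
      have : (univ.filter fun i => u i ∈ W) = univ.filter fun i => x (u i) = 0 := by
        ext i
        simp only [mem_filter, mem_univ, true_and]
        exact ⟨fun h => hle h, key _ (hu i)⟩
      rw [this]
      exact card_filter_add_card_filter_not _
    have ec := e1 c fun i => hall (hspan i)
    have ec' := e1 c' h1
    -- In codimension one, `W` is the kernel of `x` on the span of `c'`. That span contains all `c
    -- i` and has dimension at least `k`, so `W`, being spanned by members of `c'`, contains at
    -- least `k - 1` of them; this makes `hw` applicable to `x`.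
    have hdim : k ≤ #{i | c' i ∈ W} + 1 := by
      have hb1 : k ≤ finrank F (Submodule.span F (Set.range c)) := by
        have := hc.le_finrank_span univ
        rwa [card_univ, min_eq_right hk, coe_univ, Set.image_univ] at this
      have hb2 : finrank F (Submodule.span F (Set.range c)) ≤
          finrank F (Submodule.span F {c' j₀} ⊔ W : Submodule F V) :=
        Submodule.finrank_mono
          (Submodule.span_le.2 (Set.range_subset_iff.2 fun i => hall (hspan i)))
      have hb3 := Submodule.finrank_add_le_finrank_add_finrank (Submodule.span F {c' j₀}) W
      have hb4 : finrank F (Submodule.span F {c' j₀}) ≤ 1 := by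
        exact (finrank_span_le_card ({c' j₀} : Set V)).trans (by simp)
      have hb5 : finrank F W ≤ #{i | c' i ∈ W} := by
        have h5 : W ≤ Submodule.span F
            (((univ.filter fun i => c' i ∈ W).image c' : Finset V) : Set V) := by
          conv_lhs => rw [hQ]
          refine Submodule.span_mono ?_
          rintro _ ⟨i, hi, rfl⟩
          have : c' i ∈ W := hQ ▸ Submodule.subset_span ⟨i, hi, rfl⟩
          simp only [coe_image, coe_filter, mem_univ, true_and]
          exact ⟨i, this, rfl⟩
        exact (Submodule.finrank_mono h5).trans
          ((finrank_span_finset_le_card _).trans card_image_le)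
      omega
    have := hw x (by omega)
    omega
  · push Not at h1
    obtain ⟨j₁, hj₁⟩ := h1
    have hj₁W : c' j₁ ∉ W := fun h => hj₁ (Submodule.mem_sup_right h)
    let g : V → Submodule F V := fun v => Submodule.span F {v} ⊔ W
    let N' : Finset ι := {i | c' i ∉ W}
    let 𝓧 : Finset (Submodule F V) := N'.image fun j => g (c' j)
    have hmem : ∀ j, c' j ∉ W → g (c' j) ∈ 𝓧 := fun j hj =>
      mem_image_of_mem _ (by simpa [N'] using hj)
    have h2 : 2 ≤ #𝓧 := by
      refine one_lt_card.2 ⟨_, hmem j₀ hj₀, _, hmem j₁ hj₁W, fun h => hj₁ ?_⟩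
      change c' j₁ ∈ g (c' j₀)
      rw [h]
      exact Submodule.mem_sup_left (Submodule.mem_span_singleton_self _)
    have hX : ∀ X ∈ 𝓧, #{i | c' i ∈ X} ≤ #{i | c i ∈ X} ∧
        ∀ u : ι → V, #{i | u i ∈ X} = #{i | u i ∈ W} +
          #{i ∈ ({i | u i ∉ W} : Finset ι) | g (u i) = X} := by
      intro X hX
      obtain ⟨j, hj, rfl⟩ := mem_image.1 hX
      have hj' : c' j ∉ W := by simpa [N'] using hj
      refine ⟨ih _ (Submodule.covBy_span_singleton_sup hj').1 (insert j Q) ?_,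
        fun u => card_mem_span_singleton_sup u W _⟩
      rw [coe_insert, Set.image_insert_eq, Submodule.span_insert, ← hQ]
    -- The flats in `𝓧` share `W` and capture every `c' i` outside it. With `N = #𝓧`, `w'` and `w`
    -- the counts for `W`, and `R` the number of indices, summing gives `N w' + (R - w') ≤ N w + (R
    -- - w)`; as `N ≥ 2`, `w' ≤ w`.
    have s1 : ∑ X ∈ 𝓧, #{i | c' i ∈ X} ≤ ∑ X ∈ 𝓧, #{i | c i ∈ X} :=
      sum_le_sum fun X h => (hX X h).1
    rw [sum_congr rfl fun X h => (hX X h).2 c', sum_congr rfl fun X h => (hX X h).2 c,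
      sum_add_distrib, sum_add_distrib, sum_const, sum_const, smul_eq_mul, smul_eq_mul,
      ← card_eq_sum_card_image, sum_card_fiberwise_eq_card_filter] at s1
    have s2 : #{i ∈ ({i | c i ∉ W} : Finset ι) | g (c i) ∈ 𝓧} ≤ #{i | c i ∉ W} :=
      card_filter_le _ _
    have s3 : #{i | c i ∈ W} + #{i | c i ∉ W} = Fintype.card ι :=
      card_filter_add_card_filter_not _
    have s4 : #{i | c' i ∈ W} + #{i | c' i ∉ W} = Fintype.card ι :=
      card_filter_add_card_filter_not _
    by_contra hlt
    push Not at hlt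
    have s5 : #𝓧 * #{i | c i ∈ W} + #𝓧 ≤ #𝓧 * #{i | c' i ∈ W} := by
      rw [← Nat.mul_succ]
      exact Nat.mul_le_mul_left _ hlt
    nlinarith

open Classical in
/-- Kruskal's permutation lemma. -/
theorem exists_perm_smul_of_weight_le [FiniteDimensional F V] {c c' : ι → V} {k : ℕ}
    (hk2 : 2 ≤ k) (hk : k ≤ Fintype.card ι) (hc : HasKRank F k c)
    (hw : ∀ x : Dual F V, #{i | x (c' i) ≠ 0} + k ≤ Fintype.card ι + 1 →
      #{i | x (c i) ≠ 0} ≤ #{i | x (c' i) ≠ 0}) :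
    ∃ (σ : Equiv.Perm ι) (l : ι → F), ∀ i, c' i = l i • c (σ i) := by
  have H := card_mem_span_le hk hc hw
  have hc0 : ∀ i, c i ≠ 0 := fun i => (hc {i} (by simp; omega)).ne_zero (by simp)
  have hc'0 : ∀ i, c' i ≠ 0 := by
    intro i hi
    have h1 := H ⊥ ∅ (by simp)
    have h2 : #{i | c i ∈ (⊥ : Submodule F V)} = 0 := by
      rw [card_eq_zero, filter_eq_empty_iff]
      exact fun j _ h => hc0 j ((Submodule.mem_bot F).1 h)
    rw [h2, Nat.le_zero, card_eq_zero, filter_eq_empty_iff] at h1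
    exact h1 (mem_univ i) ((Submodule.mem_bot F).2 hi)
  have hpar : ∀ i j (v : V), c i ∈ Submodule.span F {v} → c j ∈ Submodule.span F {v} →
      i = j := by
    intro i j v hi hj
    by_contra hij
    have hli := hc {i, j} (card_le_two.trans hk2)
    rw [coe_insert, coe_singleton] at hli
    refine hli.notMem_span_of_insert (by simpa using hij) ?_
    rw [Set.image_singleton]
    obtain ⟨r, hr⟩ := Submodule.mem_span_singleton.1 hi
    obtain ⟨s, hs⟩ := Submodule.mem_span_singleton.1 hj
    have hs0 : s ≠ 0 := by
      rintro rfl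
      exact hc0 j (by rw [← hs, zero_smul])
    refine Submodule.mem_span_singleton.2 ⟨r * s⁻¹, ?_⟩
    rw [← hs, ← hr, smul_smul, mul_assoc, inv_mul_cancel₀ hs0, mul_one]
  -- Since `k ≥ 2`, a line holds at most one `c i`; hence each line through some `c' j` holds
  -- exactly one member of either family.
  have hline : ∀ j, #{i | c' i ∈ Submodule.span F {c' j}} ≤
      #{i | c i ∈ Submodule.span F {c' j}} := fun j => H _ {j} (by simp)
  have hcard : ∀ j, #{i | c i ∈ Submodule.span F {c' j}} ≤ 1 := by
    intro j
    refine card_le_one.2 fun a ha b hb => ?_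
    simp only [mem_filter, mem_univ, true_and] at ha hb
    exact hpar a b _ ha hb
  have hex : ∀ j, ∃ i, c i ∈ Submodule.span F {c' j} := by
    intro j
    have : 0 < #{i | c' i ∈ Submodule.span F {c' j}} :=
      card_pos.2 ⟨j, by simp⟩
    obtain ⟨i, hi⟩ := card_pos.1 (this.trans_le (hline j))
    exact ⟨i, by simpa using hi⟩
  choose f hf using hex
  have hf' : ∀ j, ∃ l : F, c' j = l • c (f j) := by
    intro j
    obtain ⟨r, hr⟩ := Submodule.mem_span_singleton.1 (hf j)
    have hr0 : r ≠ 0 := by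
      rintro rfl
      exact hc0 (f j) (by rw [← hr, zero_smul])
    exact ⟨r⁻¹, by rw [← hr, smul_smul, inv_mul_cancel₀ hr0, one_smul]⟩
  choose l hl using hf'
  have hinj : Function.Injective f := by
    intro i j hij
    have hmem : ∀ m, f m = f j → c' m ∈ Submodule.span F {c' j} := by
      intro m hm
      rw [hl m, hm]
      exact Submodule.smul_mem _ _ (hf j)
    refine card_le_one.1 ((hline j).trans (hcard j)) i ?_ j ?_
    · simpa using hmem i hij
    · simp
  exact ⟨Equiv.ofBijective f (Finite.injective_iff_bijective.1 hinj), l, hl⟩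


open Classical in
/-- The rank of `∑ dᵢ aᵢ ⊗ bᵢ` is bounded below by Sylvester's inequality. -/
theorem HasKRank.min_add_min_le {X Y : Type*} [Fintype X] [Fintype Y] {kA kB : ℕ}
    {a : ι → X → F} {b : ι → Y → F} (hA : HasKRank F kA a) (hB : HasKRank F kB b)
    {a' : ι → X → F} {b' : ι → Y → F} {d d' : ι → F}
    (h : ∀ x y, ∑ i, d i * (a i x * b i y) = ∑ i, d' i * (a' i x * b' i y)) :
    min #{i | d i ≠ 0} kA + min #{i | d i ≠ 0} kB ≤ #{i | d i ≠ 0} + #{i | d' i ≠ 0} := by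
  set S : Finset ι := {i | d i ≠ 0} with hS
  set S' : Finset ι := {i | d' i ≠ 0} with hS'
  let f : (S → F) →ₗ[F] (X → F) := Fintype.linearCombination F fun i : S => a i
  let g : (Y → F) →ₗ[F] (S → F) :=
    LinearMap.pi fun i : S => d i • Fintype.linearCombination F (b i)
  have hfr : min #S kA ≤ finrank F (LinearMap.range f) := by
    rw [Fintype.range_linearCombination]
    have : Set.range (fun i : S => a i) = a '' (S : Set ι) := by
      ext v
      simp
    rw [this]
    exact hA.le_finrank_span S
  have hgr : min #S kB ≤ finrank F (LinearMap.range g) := by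
    let G : Matrix S Y F := Matrix.of fun i y => d i * b i y
    have hG : G.mulVecLin = g := by
      ext v i
      simp [G, g, Fintype.linearCombination_apply, Pi.single_apply]
    have h1 : G.rank = finrank F (LinearMap.range g) := by rw [← hG]; rfl
    rw [← h1, Matrix.rank_eq_finrank_span_row]
    refine (hB.le_finrank_span S).trans (Submodule.finrank_mono (Submodule.span_le.2 ?_))
    rintro _ ⟨i, hi, rfl⟩
    have hdi : d i ≠ 0 := by simpa [hS] using hi
    have : b i = (d i)⁻¹ • G.row ⟨i, hi⟩ := by
      ext y
      simp [G, Matrix.row, hdi]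
    rw [this]
    exact Submodule.smul_mem _ _ (Submodule.subset_span ⟨_, rfl⟩)
  have hfg : finrank F (LinearMap.range (f ∘ₗ g)) ≤ #S' := by
    have hle : LinearMap.range (f ∘ₗ g) ≤
        Submodule.span F ((S'.image a' : Finset (X → F)) : Set (X → F)) := by
      rintro _ ⟨v, rfl⟩
      have hv : (f ∘ₗ g) v = ∑ i ∈ S', (d' i * ∑ y, v y * b' i y) • a' i := by
        ext x
        have h1 : (f ∘ₗ g) v x = ∑ i, d i * ((∑ y, v y * b i y) * a i x) := by
          have : ∑ i, d i * ((∑ y, v y * b i y) * a i x) =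
              ∑ i ∈ S, d i * ((∑ y, v y * b i y) * a i x) := by
            symm
            refine sum_subset (subset_univ _) fun i _ hi => ?_
            have : d i = 0 := by simpa [hS] using hi
            rw [this, zero_mul]
          rw [this, ← sum_coe_sort]
          simp [f, g, Fintype.linearCombination_apply, mul_assoc]
        have h2 : ∑ i ∈ S', (d' i * ∑ y, v y * b' i y) * a' i x =
            ∑ i, d' i * ((∑ y, v y * b' i y) * a' i x) := by
          simp only [mul_assoc]
          refine sum_subset (subset_univ _) fun i _ hi => ?_
          have : d' i = 0 := by simpa [hS'] using hi
          rw [this, zero_mul]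
        have h3 : ∀ (e : ι → F) (u : ι → X → F) (w : ι → Y → F),
            ∑ i, e i * ((∑ y, v y * w i y) * u i x) =
              ∑ y, v y * ∑ i, e i * (u i x * w i y) := by
          intro e u w
          simp only [sum_mul, mul_sum]
          rw [sum_comm]
          exact sum_congr rfl fun _ _ => sum_congr rfl fun _ _ => by ring
        simp only [Finset.sum_apply, Pi.smul_apply, smul_eq_mul]
        rw [h1, h2, h3, h3]
        simp only [h]
      rw [hv]
      refine Submodule.sum_mem _ fun i hi => Submodule.smul_mem _ _ (Submodule.subset_span ?_)
      rw [coe_image]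
      exact ⟨i, hi, rfl⟩
    exact (Submodule.finrank_mono hle).trans
      ((finrank_span_finset_le_card _).trans card_image_le)
  -- Sylvester's inequality: restricting `f` to the range of `g` loses at most the kernel of `f`.
  have hsyl : finrank F (LinearMap.range f) + finrank F (LinearMap.range g) ≤
      #S + finrank F (LinearMap.range (f ∘ₗ g)) := by
    have e1 := f.finrank_range_add_finrank_ker
    have e2 := (f.domRestrict (LinearMap.range g)).finrank_range_add_finrank_ker
    have e3 : finrank F (LinearMap.ker (f.domRestrict (LinearMap.range g))) ≤
        finrank F (LinearMap.ker f) := by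
      have := LinearMap.finrank_le_finrank_of_injective
        (f := ((LinearMap.range g).subtype.restrict
          (p := LinearMap.ker (f.domRestrict (LinearMap.range g))) (q := LinearMap.ker f)
          (fun v hv => hv)))
        (fun u v huv => by
          exact Subtype.ext (Subtype.ext (congrArg (fun w : LinearMap.ker f => (w : S → F)) huv)))
      exact this
    have e4 : LinearMap.range (f.domRestrict (LinearMap.range g)) =
        LinearMap.range (f ∘ₗ g) := by
      rw [LinearMap.range_domRestrict, LinearMap.range_comp]
    rw [e4] at e2
    simp only [finrank_fintype_fun_eq_card, Fintype.card_coe] at e1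
    omega
  omega

-- If the support of `d` exceeded `kA` or `kB`, the rank bound would contradict `hk`; otherwise both
-- minima equal its size, which can then be cancelled. This provides the weight hypothesis of the
-- permutation lemma.
open Classical in
theorem HasKRank.card_support_le {X Y : Type*} [Fintype X] [Fintype Y] {kA kB kC : ℕ}
    {a : ι → X → F} {b : ι → Y → F} (hA : HasKRank F kA a) (hB : HasKRank F kB b)
    (hkA : kA ≤ Fintype.card ι) (hkB : kB ≤ Fintype.card ι)
    (hk : 2 * Fintype.card ι + 2 ≤ kA + kB + kC)
    {a' : ι → X → F} {b' : ι → Y → F} {d d' : ι → F}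
    (h : ∀ x y, ∑ i, d i * (a i x * b i y) = ∑ i, d' i * (a' i x * b' i y))
    (hd' : #{i | d' i ≠ 0} + kC ≤ Fintype.card ι + 1) :
    #{i | d i ≠ 0} ≤ #{i | d' i ≠ 0} := by
  have h1 := hA.min_add_min_le hB h
  have h2 : #{i | d i ≠ 0} ≤ Fintype.card ι := card_le_univ _
  omega

theorem dual_sum_mul {X Y Z : Type*} {a : ι → X → F} {b : ι → Y → F} {c : ι → Z → F}
    {a' : ι → X → F} {b' : ι → Y → F} {c' : ι → Z → F}
    (h : ∀ x y z, ∑ i, a i x * b i y * c i z = ∑ i, a' i x * b' i y * c' i z)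
    (f : Dual F (Z → F)) (x : X) (y : Y) :
    ∑ i, f (c i) * (a i x * b i y) = ∑ i, f (c' i) * (a' i x * b' i y) := by
  have h1 : ∑ i, (a i x * b i y) • c i = ∑ i, (a' i x * b' i y) • c' i := by
    ext z
    simpa using h x y z
  simpa [mul_comm] using congrArg f h1

open Classical in
/-- If the summands of two decompositions agree in the last factor and are permuted in the first,
the permutation preserves every small support of a functional on the last factor. -/
theorem HasKRank.perm_mem_support {X Y : Type*} [Fintype X] [Fintype Y] {kA kB kC : ℕ}
    {a : ι → X → F} {b : ι → Y → F} (hA : HasKRank F kA a) (hB : HasKRank F kB b)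
    (hkA : kA ≤ Fintype.card ι) (hkB : kB ≤ Fintype.card ι)
    (hk : 2 * Fintype.card ι + 2 ≤ kA + kB + kC)
    {b' : ι → Y → F} {d : ι → F} {σ : Equiv.Perm ι}
    (h : ∀ x y, ∑ i, d i * (a i x * b i y) = ∑ i, d i * (a (σ i) x * b' i y))
    (hd : #{i | d i ≠ 0} + kC ≤ Fintype.card ι + 1) {j : ι} (hj : d j ≠ 0) : d (σ j) ≠ 0 := by
  set S : Finset ι := {i | d i ≠ 0} with hS
  have hmemS : ∀ i, i ∈ S ↔ d i ≠ 0 := fun i => by simp [hS]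
  -- For `j ∈ S` outside `σ(S)`, a functional isolating `b j` among the independent `b i`, `i ∈ S`,
  -- puts `a j` in the span of `a` on `σ(S)`. The hypotheses give `#S + 1 ≤ kA`, so this contradicts
  -- independence.
  have hsub : S ⊆ S.image σ := by
    intro j hj
    by_contra hjS
    have hli := hA (insert j (S.image σ)) (by
      have h1 := card_insert_le j (S.image σ)
      have h2 := card_image_le (s := S) (f := σ)
      omega)
    rw [coe_insert] at hli
    refine hli.notMem_span_of_insert (by exact_mod_cast hjS) ?_
    have hBS := hB S (by omega)
    obtain ⟨x, hx, hle⟩ := Submodule.exists_le_ker_of_notMem (hBS.notMem_span hj)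
    have hx0 : ∀ i, i ≠ j → d i * x (b i) = 0 := by
      intro i hij
      by_cases hi : d i = 0
      · rw [hi, zero_mul]
      · have : x (b i) = 0 :=
          hle (Submodule.subset_span ⟨i, ⟨by exact_mod_cast (hmemS i).2 hi, hij⟩, rfl⟩)
        rw [this, mul_zero]
    have key : (d j * x (b j)) • a j = ∑ i, (d i * x (b' i)) • a (σ i) := by
      ext u
      have h1 : ∑ i, (d i * a i u) • b i = ∑ i, (d i * a (σ i) u) • b' i := by
        ext y
        simpa [mul_assoc] using h u y
      have h2 := congrArg x h1
      simp only [map_sum, map_smul, smul_eq_mul] at h2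
      simp only [Pi.smul_apply, smul_eq_mul, Finset.sum_apply]
      rw [sum_eq_single j (fun i _ hij => by
        rw [mul_right_comm, hx0 i hij, zero_mul]) (by simp)] at h2
      rw [mul_right_comm, h2]
      exact sum_congr rfl fun i _ => by ring
    have hdj : d j * x (b j) ≠ 0 := mul_ne_zero ((hmemS j).1 hj) hx
    have key' : a j = (d j * x (b j))⁻¹ • ∑ i, (d i * x (b' i)) • a (σ i) := by
      rw [← key, smul_smul, inv_mul_cancel₀ hdj, one_smul]
    rw [key']
    refine Submodule.smul_mem _ _ (Submodule.sum_mem _ fun i _ => ?_)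
    by_cases hi : d i = 0
    · rw [hi, zero_mul, zero_smul]
      exact Submodule.zero_mem _
    · refine Submodule.smul_mem _ _ (Submodule.subset_span ⟨σ i, ?_, rfl⟩)
      rw [coe_image]
      exact ⟨i, by exact_mod_cast (hmemS i).2 hi, rfl⟩
  have heq : S = S.image σ := eq_of_subset_of_card_le hsub card_image_le
  rw [← hmemS, heq]
  exact mem_image_of_mem _ ((hmemS j).2 hj)

-- Take a functional vanishing on `k - 1` of the vectors, `c j` among them, but not on `c i`. It
-- separates two indices with support small enough for `HasKRank.perm_mem_support`.
open Classical in
theorem HasKRank.exists_dual {k : ℕ} {c : ι → V} (hc : HasKRank F k c) (hk2 : 2 ≤ k)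
    (hk : k ≤ Fintype.card ι) {i j : ι} (hij : i ≠ j) :
    ∃ x : Dual F V, x (c i) ≠ 0 ∧ x (c j) = 0 ∧ #{l | x (c l) ≠ 0} + k ≤ Fintype.card ι + 1 := by
  obtain ⟨Q, hjQ, hQi, hQ⟩ := exists_subsuperset_card_eq (s := {j}) (t := univ.erase i)
    (n := k - 1) (by simpa using hij.symm) (by simp; omega)
    (by rw [card_erase_of_mem (mem_univ _), card_univ]; omega)
  have hiQ : i ∉ Q := fun h => by simpa using hQi h
  have hli := hc (insert i Q) (by rw [card_insert_of_notMem hiQ]; omega)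
  rw [coe_insert] at hli
  obtain ⟨x, hx, hle⟩ := Submodule.exists_le_ker_of_notMem
    (hli.notMem_span_of_insert (by exact_mod_cast hiQ))
  have hxQ : ∀ l ∈ Q, x (c l) = 0 := fun l hl => hle (Submodule.subset_span ⟨l, hl, rfl⟩)
  refine ⟨x, hx, hxQ j (hjQ (mem_singleton_self j)), ?_⟩
  have h1 : #{l | x (c l) ≠ 0} ≤ #(univ \ Q) := by
    refine card_le_card fun l hl => ?_
    simp only [mem_filter, mem_univ, true_and] at hl
    simp only [mem_sdiff, mem_univ, true_and]
    exact fun h => hl (hxQ l h)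
  rw [card_sdiff_of_subset (subset_univ _), card_univ, hQ] at h1
  omega

/-- **Kruskal's theorem** on the uniqueness of decompositions of third-order tensors. -/
theorem kruskal {X Y Z : Type*} [Fintype X] [Fintype Y] [Fintype Z] {kA kB kC : ℕ}
    {a : ι → X → F} {b : ι → Y → F} {c : ι → Z → F}
    (hA : HasKRank F kA a) (hB : HasKRank F kB b) (hC : HasKRank F kC c)
    (hkA : kA ≤ Fintype.card ι) (hkB : kB ≤ Fintype.card ι) (hkC : kC ≤ Fintype.card ι)
    (hk : 2 * Fintype.card ι + 2 ≤ kA + kB + kC)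
    {a' : ι → X → F} {b' : ι → Y → F} {c' : ι → Z → F}
    (h : ∀ x y z, ∑ i, a i x * b i y * c i z = ∑ i, a' i x * b' i y * c' i z) :
    ∃ σ : Equiv.Perm ι, ∀ i x y z,
      a' i x * b' i y * c' i z = a (σ i) x * b (σ i) y * c (σ i) z := by
  classical
  have hrot : ∀ y z x, ∑ i, b i y * c i z * a i x = ∑ i, b' i y * c' i z * a' i x := by
    intro y z x
    have := h x y z
    simp only [mul_comm, mul_left_comm] at this ⊢
    exact this
  -- As each Kruskal rank is at most the number of summands, `hk` forces all three to be at least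
  -- `2`.
  obtain ⟨σ, l, hσ⟩ := exists_perm_smul_of_weight_le (c := c) (c' := c') (by omega) hkC hC
    (fun f hf => hA.card_support_le hB hkA hkB hk (dual_sum_mul h f) hf)
  obtain ⟨τ, m, hτ⟩ := exists_perm_smul_of_weight_le (c := a) (c' := a') (by omega) hkA hA
    (fun f hf => hB.card_support_le hC hkB hkC (by omega) (dual_sum_mul hrot f) hf)
  let ρ : Equiv.Perm ι := σ.symm.trans τ
  let e : ι → F := fun i => m (σ.symm i) * l (σ.symm i)
  have h' : ∀ x y z, ∑ i, a i x * b i y * c i z =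
      ∑ i, a (ρ i) x * (e i • b' (σ.symm i)) y * c i z := by
    intro x y z
    rw [h, ← Equiv.sum_comp σ.symm]
    refine sum_congr rfl fun i _ => ?_
    rw [hσ, hτ]
    simp only [Pi.smul_apply, smul_eq_mul, Equiv.apply_symm_apply, e, ρ, Equiv.trans_apply]
    ring
  -- The permutations found for the two factors agree: otherwise a functional nonzero at `c i` and
  -- zero at `c (ρ i)` would have a support not preserved by `ρ`.
  have hρ : ∀ i, ρ i = i := by
    intro i
    by_contra hne
    obtain ⟨f, hfi, hfj, hf⟩ := hC.exists_dual (by omega) hkC (Ne.symm hne)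
    exact hA.perm_mem_support hB hkA hkB hk (d := fun i => f (c i)) (dual_sum_mul h' f) hf hfi hfj
  have hb : ∀ i y, b i y = e i * b' (σ.symm i) y := by
    intro i y
    have h0 : ∀ x z, ∑ i, (b i y - e i * b' (σ.symm i) y) * (a i x * c i z) =
        ∑ i, (0 : ι → F) i * (a i x * c i z) := by
      intro x z
      have := h' x y z
      simp only [hρ, Pi.smul_apply, smul_eq_mul] at this
      simp only [Pi.zero_apply, zero_mul, sum_const_zero, sub_mul, sum_sub_distrib]
      rw [sub_eq_zero]
      calc _ = ∑ i, a i x * b i y * c i z := sum_congr rfl fun i _ => by ring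
        _ = _ := this
        _ = _ := sum_congr rfl fun i _ => by ring
    -- Comparing with the zero combination shows that the `a i ⊗ c i` are linearly independent.
    have := hA.card_support_le hC hkA hkC (kC := kB) (by omega) h0 (by simp; omega)
    have h1 : #{i | b i y - e i * b' (σ.symm i) y ≠ 0} = 0 := by simpa using this
    rw [card_eq_zero, filter_eq_empty_iff] at h1
    have h2 := h1 (mem_univ i)
    rw [not_not, sub_eq_zero] at h2
    exact h2
  refine ⟨σ, fun i x y z => ?_⟩
  have hτσ : τ i = σ i := by simpa [ρ] using hρ (σ i)
  rw [hσ, hτ, hb (σ i), hτσ]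
  simp only [Pi.smul_apply, smul_eq_mul, Equiv.symm_apply_apply, e]
  ring

end Kruskal

/-! ### Hadamard products, decompositions and identifiability -/

section Hadamard

variable {d m : ℕ} {n : Fin d → ℕ} {r : Fin m → ℕ}

/-- The parameters of a Hadamard product of sums of `r₁, …, r_m` tensor products: the entries of
the factors. -/
abbrev Param (n : Fin d → ℕ) (r : Fin m → ℕ) : Type :=
  (Σ k : Fin m, Fin (r k)) × (Σ j : Fin d, Fin (n j))

/-- The factors of the summand with index `i` in the expansion of a Hadamard product of sums of
tensor products. -/
def factor {A : Type*} [CommRing A] (p : Param n r → A) (i : ∀ k, Fin (r k)) (j : Fin d)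
    (l : Fin (n j)) : A :=
  ∏ k, p (⟨k, i k⟩, ⟨j, l⟩)

/-- The product of the factors indexed by the block `X`. -/
def blockVec {A : Type*} [CommRing A] (X : Finset (Fin d)) (a : ∀ j : Fin d, Fin (n j) → A)
    (t : ∀ j : Fin d, Fin (n j)) : A :=
  ∏ x ∈ X, a x (t x)

/-- The parametrization of Hadamard products of sums of tensor products. -/
def hadamardMap {A : Type*} [CommRing A] (p : Param n r → A) (t : ∀ j : Fin d, Fin (n j)) : A :=
  ∑ i : ∀ k, Fin (r k), blockVec univ (factor p i) t

theorem map_factor {A B : Type*} [CommRing A] [CommRing B] (g : A →+* B) (p : Param n r → A)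
    (i : ∀ k, Fin (r k)) (j : Fin d) (l : Fin (n j)) :
    g (factor p i j l) = factor (g ∘ p) i j l := by
  simp [factor]

theorem map_blockVec {A B : Type*} [CommRing A] [CommRing B] (g : A →+* B) (X : Finset (Fin d))
    (a : ∀ j : Fin d, Fin (n j) → A) (t : ∀ j : Fin d, Fin (n j)) :
    g (blockVec X a t) = blockVec X (fun j => g ∘ a j) t := by
  simp [blockVec]

theorem map_blockVec_factor {A B : Type*} [CommRing A] [CommRing B] (g : A →+* B)
    (X : Finset (Fin d)) (p : Param n r → A) (i : ∀ k, Fin (r k)) (t : ∀ j : Fin d, Fin (n j)) :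
    g (blockVec X (factor p i) t) = blockVec X (factor (g ∘ p) i) t := by
  simp [blockVec, map_factor]

theorem map_hadamardMap {A B : Type*} [CommRing A] [CommRing B] (g : A →+* B)
    (p : Param n r → A) (t : ∀ j : Fin d, Fin (n j)) :
    g (hadamardMap p t) = hadamardMap (g ∘ p) t := by
  simp [hadamardMap, map_blockVec_factor]

variable {F : Type*} [Field F]

theorem outer_eq_blockVec (a : ∀ j : Fin d, Fin (n j) → F) : outer a = blockVec univ a := rfl

theorem hadamardMap_eq_sum (p : Param n r → F) :
    hadamardMap p = ∑ i : ∀ k, Fin (r k), outer (factor p i) := by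
  ext t
  simp [hadamardMap, outer_eq_blockVec]

theorem hadamardMap_eq_prod (p : Param n r → F) :
    hadamardMap p = ∏ k, ∑ i : Fin (r k), outer fun j l => p (⟨k, i⟩, ⟨j, l⟩) := by
  ext t
  simp only [hadamardMap, blockVec, factor, Finset.prod_apply, Finset.sum_apply, outer]
  rw [prod_univ_sum, Fintype.piFinset_univ]
  exact sum_congr rfl fun i _ => prod_comm

theorem outer_zero (hd : 0 < d) : outer (0 : ∀ j : Fin d, Fin (n j) → F) = 0 := by
  ext t
  exact prod_eq_zero (mem_univ ⟨0, hd⟩) rfl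

theorem exists_family_map_univ {α ι : Type*} [Fintype ι] (M : Multiset α)
    (hM : Multiset.card M = Fintype.card ι) : ∃ u : ι → α, (univ : Finset ι).val.map u = M := by
  obtain ⟨l, rfl⟩ := Quot.exists_rep M
  change ∃ u : ι → α, (univ : Finset ι).val.map u = (l : Multiset α)
  have hl : l.length = Fintype.card ι := hM
  let e : ι ≃ Fin l.length := Fintype.equivFinOfCardEq hl.symm
  refine ⟨fun i => l.get (e i), ?_⟩
  have h1 : (univ : Finset ι).val.map e = (univ : Finset (Fin l.length)).val := by
    simp
  change (univ : Finset ι).val.map (l.get ∘ e) = _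
  rw [← Multiset.map_map, h1, Fin.univ_val_map, List.ofFn_get]

/-- A decomposition padded by zeros, as a family of tensor products. -/
theorem exists_family_of_mem_decompositions (hd : 0 < d) {ι : Type*} [Fintype ι] {s : ℕ}
    {T : Tensor F n} {A : Sym (Tensor F n) s} (hA : A ∈ decompositions s T)
    (hs : s ≤ Fintype.card ι) : ∃ a : ι → ∀ j : Fin d, Fin (n j) → F,
      ∑ i, outer (a i) = T ∧ (univ : Finset ι).val.map (fun i => outer (a i)) =
        (A : Multiset (Tensor F n)) + Multiset.replicate (Fintype.card ι - s) 0 := by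
  obtain ⟨u, hu⟩ := exists_family_map_univ (ι := ι)
    ((A : Multiset (Tensor F n)) + Multiset.replicate (Fintype.card ι - s) 0) (by
      rw [Multiset.card_add, Multiset.card_replicate, Sym.card_coe]
      omega)
  have hout : ∀ i, ∃ a : ∀ j : Fin d, Fin (n j) → F, u i = outer a := by
    intro i
    have hi : u i ∈ (A : Multiset (Tensor F n)) + Multiset.replicate (Fintype.card ι - s) 0 :=
      hu ▸ Multiset.mem_map_of_mem u (mem_univ i)
    rcases Multiset.mem_add.1 hi with h | h
    · exact (hA.1 _ h).2
    · exact ⟨0, by rw [outer_zero hd, Multiset.eq_of_mem_replicate h]⟩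
  choose a ha using hout
  have hu' : (fun i => outer (a i)) = u := funext fun i => (ha i).symm
  refine ⟨a, ?_, by rw [hu', hu]⟩
  change ((univ : Finset ι).val.map fun i => outer (a i)).sum = T
  rw [hu', hu, Multiset.sum_add, hA.2, Multiset.sum_replicate, smul_zero, add_zero]

theorem tensorRank_sum_outer_le {s : ℕ} (a : Fin s → ∀ j : Fin d, Fin (n j) → F) :
    tensorRank (∑ i, outer (a i)) ≤ s := by
  classical
  let M : Multiset (Tensor F n) :=
    ((univ.filter fun i => outer (a i) ≠ 0).val.map fun i => outer (a i))
  have hM : Multiset.card M ≤ s := by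
    rw [Multiset.card_map]
    exact (card_filter_le _ _).trans (by simp)
  refine le_trans (Nat.sInf_le ⟨⟨M, rfl⟩, ?_, ?_⟩) hM
  · intro B hB
    obtain ⟨i, hi, rfl⟩ := Multiset.mem_map.1 (show B ∈ M from hB)
    exact ⟨(mem_filter.1 (Finset.mem_def.2 hi)).2, a i, rfl⟩
  · change ∑ i ∈ univ.filter (fun i => outer (a i) ≠ 0), outer (a i) = _
    rw [sum_filter_ne_zero]

theorem exists_eq_sum_outer (hd : 0 < d) {s : ℕ} {T : Tensor F n} (hT : tensorRank T ≤ s) :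
    ∃ a : Fin s → ∀ j : Fin d, Fin (n j) → F, T = ∑ i, outer (a i) := by
  obtain ⟨A, hA⟩ := Nat.sInf_mem (exists_decomposition hd T)
  obtain ⟨a, ha, -⟩ := exists_family_of_mem_decompositions (ι := Fin s) hd hA
    (by rwa [Fintype.card_fin])
  exact ⟨a, ha.symm⟩

theorem hadamardMap_mem_hhdSet (p : Param n r → F) : hadamardMap p ∈ hhdSet F n r :=
  ⟨_, fun _ => tensorRank_sum_outer_le _, hadamardMap_eq_prod p⟩

theorem exists_eq_hadamardMap (hd : 0 < d) {T : Tensor F n} (hT : T ∈ hhdSet F n r) :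
    ∃ p : Param n r → F, T = hadamardMap p := by
  obtain ⟨G, hG, rfl⟩ := hT
  choose a ha using fun k => exists_eq_sum_outer hd (hG k)
  refine ⟨fun q => a q.1.1 q.1.2 q.2.1 q.2.2, ?_⟩
  rw [hadamardMap_eq_prod]
  exact prod_congr rfl fun k _ => ha k

/-- The index that agrees with `x`, `y`, `z` on `I`, `J` and the remaining positions. -/
def mergeIndex (I J : Finset (Fin d)) (x y z : ∀ j : Fin d, Fin (n j)) (j : Fin d) : Fin (n j) :=
  if j ∈ I then x j else if j ∈ J then y j else z j

theorem outer_mergeIndex {I J K : Finset (Fin d)} (hIJ : Disjoint I J) (hIK : Disjoint I K)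
    (hJK : Disjoint J K) (hIJK : I ∪ J ∪ K = univ) (a : ∀ j : Fin d, Fin (n j) → F)
    (x y z : ∀ j : Fin d, Fin (n j)) :
    outer a (mergeIndex I J x y z) = blockVec I a x * blockVec J a y * blockVec K a z := by
  unfold outer blockVec
  rw [← hIJK, prod_union (disjoint_union_left.2 ⟨hIK, hJK⟩), prod_union hIJ]
  congr 1
  · congr 1
    · exact prod_congr rfl fun j hj => by rw [mergeIndex, if_pos hj]
    · exact prod_congr rfl fun j hj => by
        rw [mergeIndex, if_neg (disjoint_right.1 hIJ hj), if_pos hj]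
  · exact prod_congr rfl fun j hj => by
      rw [mergeIndex, if_neg (disjoint_right.1 hIK hj), if_neg (disjoint_right.1 hJK hj)]

theorem outer_eq_mul {I J K : Finset (Fin d)} (hIJ : Disjoint I J) (hIK : Disjoint I K)
    (hJK : Disjoint J K) (hIJK : I ∪ J ∪ K = univ) (a : ∀ j : Fin d, Fin (n j) → F)
    (t : ∀ j : Fin d, Fin (n j)) :
    outer a t = blockVec I a t * blockVec J a t * blockVec K a t := by
  unfold outer blockVec
  rw [← hIJK, prod_union (disjoint_union_left.2 ⟨hIK, hJK⟩), prod_union hIJ]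

/-- Kruskal's theorem for a tensor of arbitrary order reshaped to order three. -/
theorem exists_perm_outer_eq {I J K : Finset (Fin d)} (hIJ : Disjoint I J) (hIK : Disjoint I K)
    (hJK : Disjoint J K) (hIJK : I ∪ J ∪ K = univ) {ι : Type*} [Fintype ι]
    {a b : ι → ∀ j : Fin d, Fin (n j) → F} {kI kJ kK : ℕ}
    (hI : HasKRank F kI fun i => blockVec I (a i))
    (hJ : HasKRank F kJ fun i => blockVec J (a i))
    (hK : HasKRank F kK fun i => blockVec K (a i))
    (hkI : kI ≤ Fintype.card ι) (hkJ : kJ ≤ Fintype.card ι) (hkK : kK ≤ Fintype.card ι)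
    (hk : Fintype.card ι = 1 ∨ 2 * Fintype.card ι + 2 ≤ kI + kJ + kK)
    (h : ∑ i, outer (a i) = ∑ i, outer (b i)) :
    ∃ σ : Equiv.Perm ι, ∀ i, outer (b i) = outer (a (σ i)) := by
  -- A single summand never satisfies Kruskal's inequality, since the three ranks add up to at most
  -- `3 < 4`.
  rcases hk with hk | hk
  · obtain ⟨i₀, hi₀⟩ := Fintype.card_eq_one_iff.1 hk
    have huniv : (univ : Finset ι) = {i₀} := by
      ext i
      simp [hi₀ i]
    refine ⟨Equiv.refl ι, fun i => ?_⟩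
    rw [huniv, sum_singleton, sum_singleton] at h
    rw [hi₀ i]
    exact h.symm
  · obtain ⟨σ, hσ⟩ := kruskal hI hJ hK hkI hkJ hkK hk (a' := fun i => blockVec I (b i))
      (b' := fun i => blockVec J (b i)) (c' := fun i => blockVec K (b i)) (by
        intro x y z
        have := congrFun h (mergeIndex I J x y z)
        simpa only [Finset.sum_apply, outer_mergeIndex hIJ hIK hJK hIJK] using this)
    refine ⟨σ, fun i => funext fun t => ?_⟩
    rw [outer_eq_mul hIJ hIK hJK hIJK, outer_eq_mul hIJ hIK hJK hIJK]
    exact hσ i t t t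

theorem outer_ne_zero_of_hasKRank {I J K : Finset (Fin d)} (hIJ : Disjoint I J)
    (hIK : Disjoint I K) (hJK : Disjoint J K) (hIJK : I ∪ J ∪ K = univ) {ι : Type*}
    {a : ι → ∀ j : Fin d, Fin (n j) → F} {kI kJ kK : ℕ}
    (hI : HasKRank F kI fun i => blockVec I (a i))
    (hJ : HasKRank F kJ fun i => blockVec J (a i))
    (hK : HasKRank F kK fun i => blockVec K (a i))
    (hkI : 1 ≤ kI) (hkJ : 1 ≤ kJ) (hkK : 1 ≤ kK) (i : ι) : outer (a i) ≠ 0 := by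
  have key : ∀ {X : Finset (Fin d)} {k : ℕ}, HasKRank F k (fun i => blockVec X (a i)) → 1 ≤ k →
      ∃ t, blockVec X (a i) t ≠ 0 := fun {X k} h hk =>
    Function.ne_iff.1 ((h {i} (by simpa using hk)).ne_zero (by simp))
  obtain ⟨x, hx⟩ := key hI hkI
  obtain ⟨y, hy⟩ := key hJ hkJ
  obtain ⟨z, hz⟩ := key hK hkK
  intro h0
  have := congrFun h0 (mergeIndex I J x y z)
  rw [outer_mergeIndex hIJ hIK hJK hIJK] at this
  exact mul_ne_zero (mul_ne_zero hx hy) hz this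

/-- A Hadamard product over `F` is identifiable if over some extension field it has a
parametrization to which Kruskal's theorem applies. -/
theorem isIdentifiable_of_hasKRank (hd : 0 < d) {Ω : Type*} [Field Ω] [Algebra F Ω]
    {I J K : Finset (Fin d)} (hIJ : Disjoint I J) (hIK : Disjoint I K) (hJK : Disjoint J K)
    (hIJK : I ∪ J ∪ K = univ) {kI kJ kK : ℕ} {p : Param n r → Ω}
    (hI : HasKRank Ω kI fun i => blockVec I (factor p i))
    (hJ : HasKRank Ω kJ fun i => blockVec J (factor p i))
    (hK : HasKRank Ω kK fun i => blockVec K (factor p i))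
    (hkI : kI ≤ ∏ k, r k) (hkJ : kJ ≤ ∏ k, r k) (hkK : kK ≤ ∏ k, r k)
    (hkI1 : 1 ≤ kI) (hkJ1 : 1 ≤ kJ) (hkK1 : 1 ≤ kK)
    (hk : ∏ k, r k = 1 ∨ 2 * ∏ k, r k + 2 ≤ kI + kJ + kK)
    {T : Tensor F n} (hT : T ∈ hhdSet F n r) (hTp : algebraMap F Ω ∘ T = hadamardMap p) :
    IsIdentifiable (∏ k, r k) T := by
  have hcard : Fintype.card (∀ k, Fin (r k)) = ∏ k, r k := by simp
  have hinj : Function.Injective fun B : Tensor F n => algebraMap F Ω ∘ B := fun B C h =>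
    funext fun t => (algebraMap F Ω).injective (congrFun h t)
  have hmap : ∀ a : ∀ j : Fin d, Fin (n j) → F,
      algebraMap F Ω ∘ outer a = outer fun j => algebraMap F Ω ∘ a j := fun a =>
    funext fun t => map_blockVec (algebraMap F Ω) univ a t
  have huniq : ∀ a : (∀ k, Fin (r k)) → ∀ j : Fin d, Fin (n j) → F, ∑ i, outer (a i) = T →
      ∃ σ : Equiv.Perm (∀ k, Fin (r k)),
        ∀ i, algebraMap F Ω ∘ outer (a i) = outer (factor p (σ i)) := by
    intro a ha
    obtain ⟨σ, hσ⟩ := exists_perm_outer_eq hIJ hIK hJK hIJK hI hJ hK (by rwa [hcard])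
      (by rwa [hcard]) (by rwa [hcard]) (by rwa [hcard])
      (b := fun i j => algebraMap F Ω ∘ a i j) (by
        rw [← hadamardMap_eq_sum, ← hTp, ← ha]
        simp only [← hmap]
        ext t
        simp)
    exact ⟨σ, fun i => by rw [hmap, hσ]⟩
  obtain ⟨p₀, hp₀⟩ := exists_eq_hadamardMap hd hT
  rw [hadamardMap_eq_sum] at hp₀
  obtain ⟨σ₀, hσ₀⟩ := huniq _ hp₀.symm
  have hne : ∀ (a : (∀ k, Fin (r k)) → ∀ j : Fin d, Fin (n j) → F)
      (σ : Equiv.Perm (∀ k, Fin (r k))),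
      (∀ i, algebraMap F Ω ∘ outer (a i) = outer (factor p (σ i))) → ∀ i, outer (a i) ≠ 0 := by
    intro a σ hσ i h0
    refine outer_ne_zero_of_hasKRank hIJ hIK hJK hIJK hI hJ hK hkI1 hkJ1 hkK1 (σ i) ?_
    rw [← hσ, h0]
    ext t
    simp
  let M₀ : Multiset (Tensor F n) :=
    (univ : Finset (∀ k, Fin (r k))).val.map fun i => outer (factor p₀ i)
  have hM₀ : Multiset.card M₀ = ∏ k, r k := by
    rw [Multiset.card_map, ← hcard]
    rfl
  have hdec : (⟨M₀, hM₀⟩ : Sym (Tensor F n) (∏ k, r k)) ∈ decompositions (∏ k, r k) T := by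
    refine ⟨fun B hB => ?_, hp₀.symm⟩
    obtain ⟨i, -, rfl⟩ := Multiset.mem_map.1 (show B ∈ M₀ from hB)
    exact ⟨hne _ _ hσ₀ i, _, rfl⟩
  -- Shorter decompositions are padded by zeros to the full length. Uniqueness makes every summand
  -- nonzero, so there is no padding; this gives the rank as well as uniqueness.
  have key : ∀ (s : ℕ) (A : Sym (Tensor F n) s), A ∈ decompositions s T → s ≤ ∏ k, r k →
      s = ∏ k, r k ∧ (A : Multiset (Tensor F n)) = M₀ := by
    intro s A hA hs
    obtain ⟨a, ha, hMa⟩ := exists_family_of_mem_decompositions (ι := ∀ k, Fin (r k)) hd hA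
      (by rwa [hcard])
    obtain ⟨σ, hσ⟩ := huniq a ha
    have hs' : s = ∏ k, r k := by
      refine le_antisymm hs (not_lt.1 fun hlt => ?_)
      have h0 : (0 : Tensor F n) ∈
          (univ : Finset (∀ k, Fin (r k))).val.map fun i => outer (a i) := by
        rw [hMa, Multiset.mem_add, Multiset.mem_replicate, hcard]
        exact Or.inr ⟨by omega, rfl⟩
      obtain ⟨i, -, hi⟩ := Multiset.mem_map.1 h0
      exact hne a σ hσ i hi
    refine ⟨hs', ?_⟩
    rw [hcard, Nat.sub_eq_zero_of_le hs'.ge, Multiset.replicate_zero, add_zero] at hMa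
    rw [← hMa]
    have h1 : (fun i => outer (a i)) =
        (fun i => outer (factor p₀ i)) ∘ (σ.trans σ₀.symm) := by
      funext i
      apply hinj
      simp only [Function.comp_apply]
      rw [hσ, hσ₀]
      simp
    have h2 : (univ : Finset (∀ k, Fin (r k))).val.map (σ.trans σ₀.symm) = univ.val := by
      have := congrArg Finset.val (Finset.map_univ_equiv (σ.trans σ₀.symm))
      rwa [Finset.map_val] at this
    rw [h1, ← Multiset.map_map, h2]
  refine ⟨le_antisymm (Nat.sInf_le ⟨_, hdec⟩) ?_, ⟨M₀, hM₀⟩, ?_⟩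
  · refine le_csInf ⟨_, _, hdec⟩ fun s ⟨A, hA⟩ => ?_
    by_contra hlt
    exact hlt (key s A hA (not_le.1 hlt).le).1.ge
  · ext A
    refine ⟨fun hA => ?_, fun hA => ?_⟩
    · exact Subtype.ext (key _ A hA le_rfl).2
    · rw [Set.mem_singleton_iff.1 hA]
      exact hdec

end Hadamard

/-! ### A Vandermonde parameter of full Kruskal rank -/

section Witness

variable {d m : ℕ} {n : Fin d → ℕ} {r : Fin m → ℕ}

/-- Mixed radix weights: every `t < ∏ x ∈ X, n x` is a weighted sum of the digits of an index. -/
theorem exists_radix_weights (hn : ∀ j, 0 < n j) (X : Finset (Fin d)) :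
    ∃ w : Fin d → ℕ, ∀ t < ∏ x ∈ X, n x,
      ∃ l : ∀ j : Fin d, Fin (n j), ∑ x ∈ X, (l x : ℕ) * w x = t := by
  classical
  induction X using Finset.induction_on with
  | empty =>
    refine ⟨0, fun t ht => ⟨fun j => ⟨0, hn j⟩, ?_⟩⟩
    rw [prod_empty] at ht
    simp; omega
  | insert a X ha ih =>
    obtain ⟨w, hw⟩ := ih
    refine ⟨fun x => if x = a then 1 else n a * w x, fun t ht => ?_⟩
    rw [prod_insert ha] at ht
    obtain ⟨l, hl⟩ := hw (t / n a) (Nat.div_lt_of_lt_mul ht)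
    refine ⟨Function.update l a ⟨t % n a, Nat.mod_lt _ (hn a)⟩, ?_⟩
    rw [sum_insert ha]
    have : ∑ x ∈ X, ((Function.update l a ⟨t % n a, Nat.mod_lt _ (hn a)⟩ x : Fin (n x)) : ℕ) *
        (if x = a then 1 else n a * w x) = n a * ∑ x ∈ X, (l x : ℕ) * w x := by
      rw [mul_sum]
      refine sum_congr rfl fun x hx => ?_
      have hxa : x ≠ a := fun h => ha (h ▸ hx)
      rw [Function.update_of_ne hxa, if_neg hxa]
      ring
    rw [this, hl, Function.update_self]
    simp only [if_true, mul_one]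
    exact Nat.mod_add_div t (n a)

/-- Parameters for which all factors are powers of the nodes of a Vandermonde matrix. -/
def vandermondeParam (F : Type*) [Field F] (n : Fin d → ℕ) (r : Fin m → ℕ) (w : Fin d → ℕ) :
    Param n r → F :=
  fun q => 2 ^ (((q.1.2 : ℕ) * ∏ j, r (Fin.castLE q.1.1.is_lt.le j)) * ((q.2.2 : ℕ) * w q.2.1))

/-- Two positional systems meet in the exponent: the product over `k` assembles the digits of `i`
into its number, which fixes the node, and the product over `X` assembles the digits of `t` into the
power of that node. -/
theorem blockVec_vandermondeParam (F : Type*) [Field F] (w : Fin d → ℕ) (X : Finset (Fin d))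
    (i : ∀ k, Fin (r k)) (t : ∀ j, Fin (n j)) :
    blockVec X (factor (vandermondeParam F n r w) i) t =
      ((2 : F) ^ (finPiFinEquiv i : ℕ)) ^ (∑ x ∈ X, (t x : ℕ) * w x) := by
  simp only [blockVec, factor, vandermondeParam]
  rw [← prod_pow_eq_pow_sum]
  refine prod_congr rfl fun x _ => ?_
  rw [prod_pow_eq_pow_sum, ← pow_mul, finPiFinEquiv_apply, sum_mul]

/-- The square submatrix of the matrix of factors of the block `X` with columns `s` and rows given
by an initial segment of `row`. -/
noncomputable def blockMatrix {A : Type*} [CommRing A] (X : Finset (Fin d)) (row : ℕ → ∀ j, Fin (n j))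
    (p : Param n r → A) (s : Finset (∀ k, Fin (r k))) : Matrix (Fin #s) (Fin #s) A :=
  Matrix.of fun u v => blockVec X (factor p (s.equivFin.symm u)) (row v)

theorem map_det_blockMatrix {A B : Type*} [CommRing A] [CommRing B] (g : A →+* B)
    (X : Finset (Fin d)) (row : ℕ → ∀ j, Fin (n j)) (p : Param n r → A)
    (s : Finset (∀ k, Fin (r k))) :
    g (blockMatrix X row p s).det = (blockMatrix X row (g ∘ p) s).det := by
  rw [RingHom.map_det]
  congr 1
  ext u v
  exact map_blockVec_factor g X p _ _

theorem linearIndepOn_of_det_blockMatrix_ne_zero {F : Type*} [Field F] {X : Finset (Fin d)}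
    {row : ℕ → ∀ j, Fin (n j)} {p : Param n r → F} {s : Finset (∀ k, Fin (r k))}
    (h : (blockMatrix X row p s).det ≠ 0) :
    LinearIndepOn F (fun i => blockVec X (factor p i)) (s : Set (∀ k, Fin (r k))) := by
  have h1 := Matrix.linearIndependent_rows_of_det_ne_zero h
  let restr : Tensor F n →ₗ[F] (Fin #s → F) := LinearMap.funLeft F F fun v : Fin #s => row v
  have h2 : LinearIndependent F
      ((fun i : s => blockVec X (factor p i)) ∘ s.equivFin.symm) :=
    LinearIndependent.of_comp restr h1
  exact (linearIndependent_equiv s.equivFin.symm).1 h2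

theorem det_blockMatrix_vandermondeParam_ne_zero (F : Type*) [Field F] [CharZero F]
    {X : Finset (Fin d)} {w : Fin d → ℕ} {row : ℕ → ∀ j, Fin (n j)}
    {s : Finset (∀ k, Fin (r k))} (h : ∀ t < #s, ∑ x ∈ X, (row t x : ℕ) * w x = t) :
    (blockMatrix X row (vandermondeParam F n r w) s).det ≠ 0 := by
  have : blockMatrix X row (vandermondeParam F n r w) s =
      Matrix.vandermonde fun u =>
        (2 : F) ^ (finPiFinEquiv (s.equivFin.symm u : ∀ k, Fin (r k)) : ℕ) := by
    ext u v
    rw [blockMatrix, Matrix.of_apply, blockVec_vandermondeParam, h v v.2, Matrix.vandermonde_apply]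
  rw [this, Matrix.det_vandermonde_ne_zero_iff]
  intro u v huv
  have h1 : (2 : ℕ) ^ (finPiFinEquiv (s.equivFin.symm u : ∀ k, Fin (r k)) : ℕ) =
      2 ^ (finPiFinEquiv (s.equivFin.symm v : ∀ k, Fin (r k)) : ℕ) := by
    have huv' : (2 : F) ^ (finPiFinEquiv (s.equivFin.symm u : ∀ k, Fin (r k)) : ℕ) =
        2 ^ (finPiFinEquiv (s.equivFin.symm v : ∀ k, Fin (r k)) : ℕ) := huv
    exact_mod_cast huv'
  -- Characteristic zero makes distinct powers of `2` distinct nodes.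
  have h2 := Nat.pow_right_injective le_rfl h1
  exact s.equivFin.symm.injective (Subtype.ext (finPiFinEquiv.injective (Fin.ext h2)))

open MvPolynomial in
/-- The condition that the factors of a block have full Kruskal rank contains a nonempty
basic open set of parameters. -/
theorem exists_polynomial_hasKRank {F Ω : Type*} [Field F] [CharZero F] [Field Ω] [Algebra F Ω]
    (hn : ∀ j, 0 < n j) (X : Finset (Fin d)) (w : Fin d → ℕ)
    (hw : ∀ t < ∏ x ∈ X, n x, ∃ l : ∀ j : Fin d, Fin (n j), ∑ x ∈ X, (l x : ℕ) * w x = t) :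
    ∃ b : MvPolynomial (Param n r) F, eval (vandermondeParam F n r w) b ≠ 0 ∧
      ∀ p : Param n r → Ω, aeval p b ≠ 0 →
        HasKRank Ω (∏ x ∈ X, n x) fun i => blockVec X (factor p i) := by
  classical
  have : Nonempty (∀ j, Fin (n j)) := ⟨fun j => ⟨0, hn j⟩⟩
  choose! row hrow using hw
  refine ⟨∏ s ∈ univ.filter fun s : Finset (∀ k, Fin (r k)) => #s ≤ ∏ x ∈ X, n x,
    (blockMatrix X row (MvPolynomial.X (R := F)) s).det, ?_, fun p hp s hs => ?_⟩
  · rw [map_prod, prod_ne_zero_iff]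
    intro s hs
    rw [map_det_blockMatrix]
    have hX : eval (vandermondeParam F n r w) ∘ MvPolynomial.X = vandermondeParam F n r w := by
      ext q
      simp
    rw [hX]
    exact det_blockMatrix_vandermondeParam_ne_zero F fun t ht =>
      hrow t (ht.trans_le (mem_filter.1 hs).2)
  · rw [map_prod, prod_ne_zero_iff] at hp
    have h1 := hp s (mem_filter.2 ⟨mem_univ _, hs⟩)
    have hX : (aeval p : MvPolynomial (Param n r) F →ₐ[F] Ω).toRingHom ∘ MvPolynomial.X = p := by
      ext q
      simp
    have h2 := map_det_blockMatrix (aeval p : MvPolynomial (Param n r) F →ₐ[F] Ω).toRingHom X row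
      MvPolynomial.X s
    rw [hX] at h2
    exact linearIndepOn_of_det_blockMatrix_ne_zero (h2 ▸ h1)

open MvPolynomial in
theorem aeval_hadamardMap_X {F L : Type*} [Field F] [Field L] [Algebra F L] (p : Param n r → L)
    (t : ∀ j, Fin (n j)) :
    aeval p (hadamardMap (X : Param n r → MvPolynomial (Param n r) F) t) = hadamardMap p t := by
  have hX : (aeval p : MvPolynomial (Param n r) F →ₐ[F] L).toRingHom ∘ X = p := by
    ext q
    simp
  have := map_hadamardMap (aeval p : MvPolynomial (Param n r) F →ₐ[F] L).toRingHom X t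
  rwa [hX] at this

end Witness

/-! ### Genericity and the main theorem -/

/-- The two terms of the minimum serve Kruskal's inequality in two cases: `δ` when `Π_J < R ≤ Π_I`,
and `δ / 2` when `R > Π_I`. -/
theorem InKruskalRange.card_bound {d : ℕ} {n : Fin d → ℕ} {I J K : Finset (Fin d)} {R : ℕ}
    (h : InKruskalRange n I J K R) :
    R + 2 ≤ ∏ x ∈ J, n x + ∏ x ∈ K, n x ∧
      2 * R + 2 ≤ ∏ x ∈ I, n x + ∏ x ∈ J, n x + ∏ x ∈ K, n x := by
  obtain ⟨-, -, -, h⟩ := h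
  have h1 := h.trans (add_le_add_right (min_le_left _ _) _)
  have h2 := h.trans (add_le_add_right (min_le_right _ _) _)
  constructor
  · have : (R : ℚ) + 2 ≤ ∏ x ∈ J, (n x : ℚ) + ∏ x ∈ K, (n x : ℚ) := by linarith
    exact_mod_cast this
  · have : 2 * (R : ℚ) + 2 ≤ ∏ x ∈ I, (n x : ℚ) + ∏ x ∈ J, (n x : ℚ) + ∏ x ∈ K, (n x : ℚ) := by
      linarith
    exact_mod_cast this

open MvPolynomial in
/-- Over an algebraically closed extension `Ω`, a generic point of the variety of Hadamard products
has a parametrization, and it is identifiable if it is a Hadamard product over the base field. -/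
theorem generically_isIdentifiable {𝕜 : Type*} [Field 𝕜] [CharZero 𝕜] (Ω : Type*) [Field Ω]
    [IsAlgClosed Ω] [Algebra 𝕜 Ω] {d m : ℕ} (n : Fin d → ℕ)
    (r : Fin m → ℕ) (hr : ∀ k, 1 ≤ r k) (I J K : Finset (Fin d))
    (hIJ : Disjoint I J) (hIK : Disjoint I K) (hJK : Disjoint J K)
    (hIJK : I ∪ J ∪ K = Finset.univ)
    (hR : InKruskalRange n I J K (∏ k, r k)) :
    Generically (hhdVariety 𝕜 n r) fun T =>
      (∃ p : Param n r → Ω, algebraMap 𝕜 Ω ∘ T = hadamardMap p) ∧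
        (T ∈ hhdSet 𝕜 n r → IsIdentifiable (∏ k, r k) T) := by
  obtain ⟨hJI, hKJ, hK2, -⟩ := id hR
  obtain ⟨hb1, hb2⟩ := hR.card_bound
  have hR1 : 1 ≤ ∏ k, r k := Finset.one_le_prod' fun k _ => hr k
  have hn : ∀ j, 0 < n j := by
    intro j
    have hpos : ∀ X : Finset (Fin d), 2 ≤ ∏ x ∈ X, n x → j ∈ X → 0 < n j := fun X hX hj =>
      Nat.pos_of_ne_zero fun h0 => by
        rw [prod_eq_zero hj h0] at hX
        omega
    have hj : j ∈ I ∪ J ∪ K := hIJK ▸ mem_univ j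
    rcases mem_union.1 hj with hj | hj
    · rcases mem_union.1 hj with hj | hj
      · exact hpos I (by omega) hj
      · exact hpos J (by omega) hj
    · exact hpos K hK2 hj
  have hd : 0 < d := by
    rcases Nat.eq_zero_or_pos d with rfl | h
    · rw [Finset.eq_empty_of_isEmpty K, prod_empty] at hK2
      omega
    · exact h
  obtain ⟨wI, hwI⟩ := exists_radix_weights hn I
  obtain ⟨wJ, hwJ⟩ := exists_radix_weights hn J
  obtain ⟨wK, hwK⟩ := exists_radix_weights hn K
  -- As the blocks are disjoint, their weights glue, and one parameter witnesses all three rank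
  -- conditions.
  let w : Fin d → ℕ := fun j => if j ∈ I then wI j else if j ∈ J then wJ j else wK j
  have hw : ∀ (X : Finset (Fin d)) (v : Fin d → ℕ), (∀ x ∈ X, w x = v x) →
      (∀ t < ∏ x ∈ X, n x, ∃ l : ∀ j : Fin d, Fin (n j), ∑ x ∈ X, (l x : ℕ) * v x = t) →
      ∀ t < ∏ x ∈ X, n x, ∃ l : ∀ j : Fin d, Fin (n j), ∑ x ∈ X, (l x : ℕ) * w x = t := by
    intro X v hv h t ht
    obtain ⟨l, hl⟩ := h t ht
    exact ⟨l, by rw [← hl]; exact sum_congr rfl fun x hx => by rw [hv x hx]⟩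
  obtain ⟨bI, hbI, HI⟩ := exists_polynomial_hasKRank (r := r) (F := 𝕜) (Ω := Ω) hn I w
    (hw I wI (fun x hx => if_pos hx) hwI)
  obtain ⟨bJ, hbJ, HJ⟩ := exists_polynomial_hasKRank (r := r) (F := 𝕜) (Ω := Ω) hn J w
    (hw J wJ (fun x hx => by simp only [w]; rw [if_neg (disjoint_right.1 hIJ hx), if_pos hx]) hwJ)
  obtain ⟨bK, hbK, HK⟩ := exists_polynomial_hasKRank (r := r) (F := 𝕜) (Ω := Ω) hn K w
    (hw K wK (fun x hx => by
      simp only [w]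
      rw [if_neg (disjoint_right.1 hIK hx), if_neg (disjoint_right.1 hJK hx)]) hwK)
  have hb : bI * bJ * bK ≠ 0 := by
    intro h0
    have := congrArg (eval (vandermondeParam 𝕜 n r w)) h0
    rw [map_mul, map_mul, map_zero] at this
    exact mul_ne_zero (mul_ne_zero hbI hbJ) hbK this
  let φ : MvPolynomial (∀ j, Fin (n j)) 𝕜 →ₐ[𝕜] MvPolynomial (Param n r) 𝕜 :=
    aeval (hadamardMap (X : Param n r → MvPolynomial (Param n r) 𝕜))
  have hφ : ∀ (p : Param n r → 𝕜) f, aeval p (φ f) = aeval (hadamardMap p) f := by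
    intro p f
    have : (aeval p).comp φ =
        (aeval (hadamardMap p) : MvPolynomial (∀ j, Fin (n j)) 𝕜 →ₐ[𝕜] 𝕜) := by
      ext t
      simp only [φ, AlgHom.comp_apply, aeval_X, aeval_hadamardMap_X]
    exact DFunLike.congr_fun this f
  obtain ⟨a, ha, H⟩ := exists_dominant_lift (Ω := Ω) φ hb
  let S := vanishingIdeal 𝕜 (hhdSet 𝕜 n r)
  refine ⟨zeroLocus 𝕜 (S ⊔ Ideal.span {a}), ⟨_, rfl⟩, ⟨zeroLocus_anti_mono le_sup_left, ?_⟩, ?_⟩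
  · intro hle
    -- The closed set is proper: `𝕜` is infinite, so the nonzero polynomial `φ a` is nonzero at some
    -- parameter, whose image lies in the variety and off `a = 0`.
    obtain ⟨p, hp⟩ : ∃ p, eval p (φ a) ≠ 0 := by
      by_contra hall
      push Not at hall
      exact ha (MvPolynomial.funext fun p => by rw [hall p, map_zero])
    have h1 := hle (zeroLocus_vanishingIdeal_le _ (hadamardMap_mem_hhdSet p)) a
      (Ideal.mem_sup_right (Ideal.mem_span_singleton_self a))
    rw [← hφ] at h1
    exact hp (by simpa [aeval_eq_eval] using h1)
  · intro T hT hTZ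
    have hTa : aeval T a ≠ 0 := by
      intro h0
      apply hTZ
      have hle : S ⊔ Ideal.span {a} ≤ RingHom.ker (aeval T : MvPolynomial _ 𝕜 →ₐ[𝕜] 𝕜) :=
        sup_le (fun f hf => hT f hf) ((Ideal.span_singleton_le_iff_mem _).2 h0)
      exact fun f hf => hle hf
    have hext : ∀ f : MvPolynomial (∀ j, Fin (n j)) 𝕜,
        aeval (algebraMap 𝕜 Ω ∘ T) f = algebraMap 𝕜 Ω (aeval T f) := fun f => by
      rw [aeval_algebraMap_apply]
    obtain ⟨p, hp, hpT⟩ := H (algebraMap 𝕜 Ω ∘ T) (fun f hf => by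
        have hfS : f ∈ S := by
          intro U hU
          obtain ⟨p, rfl⟩ := exists_eq_hadamardMap hd hU
          rw [← hφ, hf, map_zero]
        rw [hext, hT f hfS, map_zero])
      (by rw [hext]; simpa using hTa)
    have hTp : algebraMap 𝕜 Ω ∘ T = hadamardMap p := funext fun t => by
      rw [← hpT]
      simp only [φ, aeval_X, aeval_hadamardMap_X]
    refine ⟨⟨p, hTp⟩, fun hTS => ?_⟩
    rw [map_mul, map_mul] at hp
    -- Ranks are capped at `R` as Kruskal's theorem requires. If `R ≤ Π_K` the capped ranks add up
    -- to `3R`, which suffices for `R ≥ 2`; if `Π_K < R ≤ Π_J` the sum is `2R + Π_K ≥ 2R + 2`; the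
    -- other cases are `hb1` and `hb2`.
    have hmin : ∀ {X : Finset (Fin d)},
        HasKRank Ω (∏ x ∈ X, n x) (fun i => blockVec X (factor p i)) →
        HasKRank Ω (min (∏ k, r k) (∏ x ∈ X, n x)) (fun i => blockVec X (factor p i)) :=
      fun h s hs => h s (hs.trans (min_le_right _ _))
    refine isIdentifiable_of_hasKRank hd hIJ hIK hJK hIJK
      (hmin (HI p (left_ne_zero_of_mul (left_ne_zero_of_mul hp))))
      (hmin (HJ p (right_ne_zero_of_mul (left_ne_zero_of_mul hp))))
      (hmin (HK p (right_ne_zero_of_mul hp))) (min_le_left _ _) (min_le_left _ _)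
      (min_le_left _ _) ?_ ?_ ?_ ?_ hTS hTp <;> omega

end HHD

theorem mainTheorem2 {𝕜 : Type*} [Field 𝕜] [CharZero 𝕜] {d m : ℕ} (n : Fin d → ℕ)
    (r : Fin m → ℕ) (hr : ∀ k, 1 ≤ r k) (I J K : Finset (Fin d))
    (hIJ : Disjoint I J) (hIK : Disjoint I K) (hJK : Disjoint J K)
    (hIJK : I ∪ J ∪ K = Finset.univ)
    (hR : HHD.InKruskalRange n I J K (∏ k, r k)) :
    HHD.Generically (HHD.hhdVariety 𝕜 n r)
      (fun T => T ∈ HHD.hhdSet 𝕜 n r → HHD.IsIdentifiable (∏ k, r k) T) ∧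
    (IsAlgClosed 𝕜 →
      HHD.Generically (HHD.hhdVariety 𝕜 n r) (HHD.IsIdentifiable (∏ k, r k))) := by
  constructor
  · obtain ⟨Z, hZ, hZV, h⟩ := HHD.generically_isIdentifiable (𝕜 := 𝕜) (AlgebraicClosure 𝕜) n r hr
      I J K hIJ hIK hJK hIJK hR
    exact ⟨Z, hZ, hZV, fun T hT hTZ => (h T hT hTZ).2⟩
  · intro _
    obtain ⟨Z, hZ, hZV, h⟩ := HHD.generically_isIdentifiable (𝕜 := 𝕜) 𝕜 n r hr I J K
      hIJ hIK hJK hIJK hR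
    refine ⟨Z, hZ, hZV, fun T hT hTZ => ?_⟩
    obtain ⟨⟨p, hp⟩, hid⟩ := h T hT hTZ
    have hTp : T = HHD.hadamardMap p := by simpa using hp
    exact hid (hTp ▸ HHD.hadamardMap_mem_hhdSet p)
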